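/- **Online Min-Sum Set Cover (MSSC).** Let $U$ be a universe of $n$ elements. An input $\mathcal I=(\pi_0,R_1,\dots,R_m)$ consists of an initial ordering of $U$, that is, a bijection $\pi_0:U\to\{1,\dots,n\}$ giving the position of every element on a list, and of a finite sequence of nonempty sets $R_1,\dots,R_m\subseteq U$. In step $t$ an algorithm sees $R_t$, pays the access cost $\min_{x\in R_t}\pi_{t-1}(x)$, and then chooses a new ordering $\pi_t$, paying the reordering cost $d(\pi_{t-1},\pi_t)$, the number of inversions between $\pi_{t-1}$ and $\pi_t$ (the Kendall tau distance). An online algorithm chooses $\pi_t$ without knowing $R_{t+1},R_{t+2},\dots$ or $m$; a randomized one may use random choices that are independent of the input. $\mathrm{Alg}(\mathcal I)$ is the total cost of the algorithm, and $\mathrm{Opt}(\mathcal I)$ is the least total cost of any sequence $\pi_1,\dots,\pi_m$ of orderings, chosen with full knowledge of $\mathcal I$ (the dynamic optimum). **Theorem.** There is a constant $C$ such that the following two statements hold. 1. There is a randomized online algorithm $\mathrm{Alg}$ for MSSC that is $C r^2$-competitive: there is a $\xi\ge 0$ such that for every $n$, every $r$ and every input $\mathcal I$ on $n$ elements all of whose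 sets have cardinality at most $r$, $$\mathbf E[\mathrm{Alg}(\mathcal I)]\le C\,r^2\cdot \mathrm{Opt}(\mathcal I)+\xi .$$ 2. There is a deterministic online algorithm $\mathrm{Alg}$ for MSSC that is $C r^4$-competitive: there is a $\xi\ge 0$ such that for every $n$, every $r$ and every input $\mathcal I$ on $n$ elements all of whose sets have cardinality at most $r$, $$\mathrm{Alg}(\mathcal I)\le C\,r^4\cdot \mathrm{Opt}(\mathcal I)+\xi .$$ The algorithms know $n$ (and $U$, $\pi_0$), but are not told $r$; neither $C$ nor $\xi$ depends on $n$, $r$ or the input. -/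

import Mathlib

open scoped NNReal ENNReal

noncomputable section

namespace MSSC

/-- A list ordering of the `n` elements of the universe `Fin n`, given as the bijection that sends
an element to its place on the list; places are counted from `0` here, see `pos`. -/
abbrev ListOrder (n : ℕ) : Type := Equiv.Perm (Fin n)

/-- A requested set: a nonempty set of elements. -/
abbrev Request (n : ℕ) : Type := {R : Finset (Fin n) // R.Nonempty}

variable {n : ℕ}

/-- The position of `x` on the list, in `{1, …, n}`. -/
def pos (π : ListOrder n) (x : Fin n) : ℕ := (π x : ℕ) + 1

/-- The access cost: the position of the first element of `R` on the list. -/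
def accessCost (π : ListOrder n) (R : Request n) : ℕ := R.1.inf' R.2 (pos π)

/-- The reordering cost: the number of inversions (Kendall tau distance), that is of
pairs of elements that the two lists order differently. -/
def reorderCost (π σ : ListOrder n) : ℕ :=
  (Finset.univ.filter fun p : Fin n × Fin n => pos π p.1 < pos π p.2 ∧ pos σ p.2 < pos σ p.1).card

/-- The total cost on the requests `R₁, …, Rₘ` of the solution that starts with the ordering `π₀`
and has the ordering `πₜ` after step `t`, where `[π₁, …, πₘ]` is the last argument. In step `t` the
access cost is paid on `πₜ₋₁`, and then the reordering from `πₜ₋₁` to `πₜ`.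
Only lists of equal length are ever used. -/
def totalCost : ListOrder n → List (Request n) → List (ListOrder n) → ℕ
  | π, R :: Rs, π' :: πs => accessCost π R + reorderCost π π' + totalCost π' Rs πs
  | _, _, _ => 0

/-- The cost of an optimal offline (dynamic) solution. -/
def opt (π₀ : ListOrder n) (Rs : List (Request n)) : ℕ :=
  sInf {k | ∃ πs : List (ListOrder n), πs.length = Rs.length ∧ totalCost π₀ Rs πs = k}

/-- A deterministic online algorithm for a universe of `n` elements: from the initial ordering and
the requests seen so far, in the order of their arrival, it determines its current ordering. -/
structure DetAlg (n : ℕ) where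
  next : ListOrder n → List (Request n) → ListOrder n

/-- The orderings `[π₁, …, πₘ]` chosen by a deterministic algorithm; `πₜ` depends
on `π₀, R₁, …, Rₜ` only. -/
def DetAlg.run (A : DetAlg n) (π₀ : ListOrder n) (Rs : List (Request n)) : List (ListOrder n) :=
  (List.range Rs.length).map fun t => A.next π₀ (Rs.take (t + 1))

/-- The cost of a deterministic algorithm on an input. -/
def DetAlg.cost (A : DetAlg n) (π₀ : ListOrder n) (Rs : List (Request n)) : ℕ :=
  totalCost π₀ Rs (A.run π₀ Rs)

/-- A randomized online algorithm for a universe of `n` elements: it has an internal state (which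
may record everything seen and done so far), draws its first state knowing the initial ordering, and
on each request draws a new state and a new ordering from a distribution that depends on
its current state and on the request only. -/
structure RandAlg (n : ℕ) where
  State : Type
  init : ListOrder n → PMF State
  step : State → Request n → PMF (State × ListOrder n)

/-- The distribution of the sequence of orderings chosen on given requests from a given state. -/
def RandAlg.runFrom (A : RandAlg n) : A.State → List (Request n) → PMF (List (ListOrder n))
  | _, [] => PMF.pure []
  | s, R :: Rs => (A.step s R).bind fun p => (A.runFrom p.1 Rs).map (List.cons p.2)

/-- The distribution of the sequence `[π₁, …, πₘ]` of orderings chosen on an input. -/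
def RandAlg.run (A : RandAlg n) (π₀ : ListOrder n) (Rs : List (Request n)) :
    PMF (List (ListOrder n)) :=
  (A.init π₀).bind fun s => A.runFrom s Rs

/-- The expected cost of a randomized algorithm on an input. -/
def RandAlg.expectedCost (A : RandAlg n) (π₀ : ListOrder n) (Rs : List (Request n)) : ℝ≥0∞ :=
  ∑' πs : List (ListOrder n), A.run π₀ Rs πs * (totalCost π₀ Rs πs : ℝ≥0∞)

/-- A deterministic algorithm (given for every universe size `n`) is `c(r)`-competitive, where `r`
bounds the cardinalities of the requested sets. The algorithm is not told `r`, and the additive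
constant depends on nothing but the algorithm. -/
def DetCompetitive (A : (n : ℕ) → DetAlg n) (c : ℕ → ℝ≥0) : Prop :=
  ∃ ξ : ℝ≥0, ∀ (n r : ℕ) (π₀ : ListOrder n) (Rs : List (Request n)),
    (∀ R ∈ Rs, R.1.card ≤ r) →
      ((A n).cost π₀ Rs : ℝ≥0) ≤ c r * (opt π₀ Rs : ℝ≥0) + ξ

/-- The same for a randomized algorithm and its expected cost. -/
def RandCompetitive (A : (n : ℕ) → RandAlg n) (c : ℕ → ℝ≥0) : Prop :=
  ∃ ξ : ℝ≥0, ∀ (n r : ℕ) (π₀ : ListOrder n) (Rs : List (Request n)),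
    (∀ R ∈ Rs, R.1.card ≤ r) →
      (A n).expectedCost π₀ Rs ≤ (c r : ℝ≥0∞) * (opt π₀ Rs : ℝ≥0∞) + (ξ : ℝ≥0∞)

end MSSC

end

noncomputable section

namespace MSSC

/-! ### Positions, ranks and moving a set to the front -/

/-! An element is fetched only once the access costs charged to it have reached its position, so its
budget pays for the move. Against an offline list, an element at positions `p` (online) and `q`
(offline) with budget `b` carries the potential `2b + (12r(p - 12rq)⁺ - 3rb)⁺`.

A request of access cost `l` raises the terms `2b` by at most `2rl` in total. If the offline access
cost is at least `l/(24r)`, it pays for this and for `l`. Otherwise the element accessed offline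
lies far too deep in the online list, and its second term falls by `3rl`, which covers both
(`potential_raisedBudget_le`).

Fetching from position `p` releases `2p`: one `p` for the inversions, the other for pushing back the
overtaken elements (`potential_lazyStep_le`). Each offline inversion costs at most `144r²`
(`potential_offline_move_le`). The potential starts at zero, so the costs telescope. -/

theorem card_filter_lt {n : ℕ} (π : ListOrder n) (x : Fin n) :
    (Finset.univ.filter fun y => π y < π x).card = (π x : ℕ) := by
  have h : (Finset.univ.filter fun y => π y < π x) = (Finset.Iio (π x)).map π.symm.toEmbedding := by
    ext y
    simp [Finset.mem_map_equiv]
  rw [h, Finset.card_map, Fin.card_Iio]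

theorem pos_injective {n : ℕ} (π : ListOrder n) : Function.Injective (pos π) := by
  intro x y h
  apply π.injective
  apply Fin.ext
  simpa [pos] using h

theorem pos_lt_pos {n : ℕ} (π : ListOrder n) (x y : Fin n) : pos π x < pos π y ↔ π x < π y := by
  simp [pos]

theorem pos_eq_card {n : ℕ} (π : ListOrder n) (x : Fin n) :
    pos π x = (Finset.univ.filter fun y => pos π y < pos π x).card + 1 := by
  simp only [pos_lt_pos, card_filter_lt]
  rfl

theorem pos_pos {n : ℕ} (π : ListOrder n) (x : Fin n) : 0 < pos π x := Nat.succ_pos _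

/-- The number of elements with a smaller key. -/
def rank {n : ℕ} (k : Fin n → ℕ) (x : Fin n) : ℕ :=
  (Finset.univ.filter fun y => k y < k x).card

theorem rank_lt {n : ℕ} (k : Fin n → ℕ) (x : Fin n) : rank k x < n := by
  have h : (Finset.univ.filter fun y => k y < k x) ⊂ Finset.univ := by
    rw [Finset.filter_ssubset]
    exact ⟨x, Finset.mem_univ _, lt_irrefl _⟩
  simpa [rank] using Finset.card_lt_card h

theorem rank_lt_rank {n : ℕ} {k : Fin n → ℕ} {x y : Fin n} (h : k x < k y) :
    rank k x < rank k y := by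
  apply Finset.card_lt_card
  rw [Finset.ssubset_iff_of_subset]
  · exact ⟨x, by simpa using h, by simp⟩
  · intro z hz
    simp only [Finset.mem_filter, Finset.mem_univ, true_and] at hz ⊢
    exact hz.trans h

theorem rank_lt_rank_iff {n : ℕ} {k : Fin n → ℕ} {x y : Fin n} :
    rank k x < rank k y ↔ k x < k y := by
  refine ⟨fun h => ?_, rank_lt_rank⟩
  by_contra hxy
  rcases (not_lt.mp hxy).lt_or_eq with h' | h'
  · exact absurd (rank_lt_rank h') (not_lt.mpr h.le)
  · simp [rank, h'] at h

/-- The ordering of the elements by increasing keys. -/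
def orderByKey {n : ℕ} (k : Fin n → ℕ) (hk : Function.Injective k) : ListOrder n :=
  Equiv.ofBijective (fun x => (⟨rank k x, rank_lt k x⟩ : Fin n)) <| by
    apply Function.Injective.bijective_of_finite
    intro x y h
    have h' : rank k x = rank k y := by simpa using h
    apply hk
    by_contra hne
    rcases lt_or_gt_of_ne hne with h'' | h''
    · exact absurd (rank_lt_rank h'') (by omega)
    · exact absurd (rank_lt_rank h'') (by omega)

theorem pos_orderByKey {n : ℕ} (k : Fin n → ℕ) (hk : Function.Injective k) (x : Fin n) :
    pos (orderByKey k hk) x = rank k x + 1 := rfl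

/-- The key that puts the members of `F` in front of all others. -/
def frontKey {n : ℕ} (π : ListOrder n) (F : Finset (Fin n)) (x : Fin n) : ℕ :=
  if x ∈ F then pos π x else n + pos π x

theorem pos_le {n : ℕ} (π : ListOrder n) (x : Fin n) : pos π x ≤ n := (π x).isLt

theorem frontKey_injective {n : ℕ} (π : ListOrder n) (F : Finset (Fin n)) :
    Function.Injective (frontKey π F) := by
  intro x y h
  apply pos_injective π
  have h1 := pos_le π x
  have h2 := pos_le π y
  have h3 := pos_pos π x
  have h4 := pos_pos π y
  simp only [frontKey] at h
  split_ifs at h <;> omega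

/-- Moves the set `F` to the front of the list; the order inside `F` and that
outside `F` are kept. -/
def moveToFront {n : ℕ} (π : ListOrder n) (F : Finset (Fin n)) : ListOrder n :=
  orderByKey (frontKey π F) (frontKey_injective π F)

theorem pos_moveToFront_of_mem {n : ℕ} (π : ListOrder n) {F : Finset (Fin n)} {x : Fin n}
    (hx : x ∈ F) : pos (moveToFront π F) x ≤ F.card := by
  rw [moveToFront, pos_orderByKey, Nat.succ_le_iff]
  apply Finset.card_lt_card
  rw [Finset.ssubset_iff_of_subset]
  · exact ⟨x, hx, by simp⟩
  · intro y hy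
    by_contra hyF
    have h1 := pos_le π x
    simp only [Finset.mem_filter, Finset.mem_univ, true_and, frontKey, hx, hyF, if_true,
      if_false] at hy
    omega

theorem pos_moveToFront_of_notMem {n : ℕ} (π : ListOrder n) {F : Finset (Fin n)} {x : Fin n}
    (hx : x ∉ F) :
    pos (moveToFront π F) x = pos π x + (F.filter fun y => pos π x < pos π y).card := by
  rw [moveToFront, pos_orderByKey, pos_eq_card π x, add_right_comm, ← pos_eq_card π x, rank,
    ← Finset.card_union_of_disjoint]
  · congr 2
    ext y
    have h1 := pos_le π y
    have h2 := pos_pos π x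
    by_cases hy : y ∈ F
    · have hne : pos π y ≠ pos π x := fun h => hx (pos_injective π h ▸ hy)
      simp only [Finset.mem_filter, Finset.mem_univ, true_and, frontKey, hx, hy, if_true,
        if_false, Finset.mem_union]
      omega
    · simp [frontKey, hx, hy]
  · rw [Finset.disjoint_left]
    intro y hy hy'
    simp only [Finset.mem_filter, Finset.mem_univ, true_and] at hy hy'
    omega

/-- In every inversion the element that was behind lies in `F`, and `y` overtakes fewer than `pos π
y` elements. -/
theorem reorderCost_moveToFront_le {n : ℕ} (π : ListOrder n) (F : Finset (Fin n)) :
    reorderCost π (moveToFront π F) ≤ ∑ y ∈ F, pos π y := by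
  have hsub : (Finset.univ.filter fun p : Fin n × Fin n =>
      pos π p.1 < pos π p.2 ∧ pos (moveToFront π F) p.2 < pos (moveToFront π F) p.1) ⊆
      F.biUnion fun y => (Finset.univ.filter fun x => pos π x < pos π y).map
        (Function.Embedding.sectL (Fin n) y) := by
    rintro ⟨x, y⟩ h
    simp only [Finset.mem_filter, Finset.mem_univ, true_and, moveToFront, pos_orderByKey,
      add_lt_add_iff_right, rank_lt_rank_iff] at h
    have hy : y ∈ F := by
      by_contra hy
      have h1 := pos_le π x
      simp only [frontKey, hy, if_false] at h
      split_ifs at h <;> omega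
    simp [hy, h.1]
  refine (Finset.card_le_card hsub).trans (Finset.card_biUnion_le.trans ?_)
  refine Finset.sum_le_sum fun y _ => ?_
  have h := pos_eq_card π y
  rw [Finset.card_map]
  omega

/-- Moves towards the front are paid for by inversions. -/
theorem sum_pos_sub_le_reorderCost {n : ℕ} (π σ : ListOrder n) :
    ∑ x, (pos π x - pos σ x) ≤ reorderCost π σ := by
  have h : reorderCost π σ =
      ∑ x, (Finset.univ.filter fun y => pos π y < pos π x ∧ pos σ x < pos σ y).card := by
    simp only [reorderCost, Finset.card_filter]
    rw [Fintype.sum_prod_type_right]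
  rw [h]
  refine Finset.sum_le_sum fun x _ => ?_
  -- Whatever precedes `x` in `π` is either overtaken by `x` or still precedes it in `σ`.
  have hsub : (Finset.univ.filter fun y => pos π y < pos π x) ⊆
      (Finset.univ.filter fun y => pos π y < pos π x ∧ pos σ x < pos σ y) ∪
      (Finset.univ.filter fun y => pos σ y < pos σ x) := by
    intro y hy
    simp only [Finset.mem_filter, Finset.mem_univ, true_and, Finset.mem_union] at hy ⊢
    have hne : pos σ y ≠ pos σ x := fun e => by
      rw [pos_injective σ e] at hy
      exact lt_irrefl _ hy
    omega
  have h1 := (Finset.card_le_card hsub).trans (Finset.card_union_le _ _)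
  have h2 := pos_eq_card π x
  have h3 := pos_eq_card σ x
  omega

theorem mul_card_filter_mul_pos_lt_le {n : ℕ} (σ : ListOrder n) (c P : ℕ) :
    c * (Finset.univ.filter fun x => c * pos σ x < P).card ≤ P := by
  rcases Nat.eq_zero_or_pos c with rfl | hc
  · simp
  have h : (Finset.univ.filter fun x => c * pos σ x < P).card ≤ (Finset.Icc 1 (P / c)).card := by
    refine Finset.card_le_card_of_injOn (pos σ) (fun x hx => ?_) (pos_injective σ).injOn
    simp only [Finset.coe_filter, Finset.mem_univ, true_and, Set.mem_ofPred_eq] at hx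
    simp only [Finset.coe_Icc, Set.mem_Icc]
    refine ⟨pos_pos σ x, ?_⟩
    rw [Nat.le_div_iff_mul_le hc, mul_comm]
    exact hx.le
  rw [Nat.card_Icc, Nat.add_sub_cancel] at h
  exact (Nat.mul_le_mul_left c h).trans (Nat.mul_div_le P c)

/-! ### The algorithm -/

/-- A state of the algorithm: its list and a budget for every element. -/
abbrev BudgetState (n : ℕ) : Type := ListOrder n × (Fin n → ℕ)

/-- The requested elements whose budget reaches their position once the access cost is added. -/
def fetchSet {n : ℕ} (s : BudgetState n) (R : Request n) : Finset (Fin n) :=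
  R.1.filter fun x => pos s.1 x ≤ s.2 x + accessCost s.1 R

/-- The budgets after the access cost has been added to those of all requested elements. -/
def raisedBudget {n : ℕ} (s : BudgetState n) (R : Request n) (x : Fin n) : ℕ :=
  s.2 x + if x ∈ R.1 then accessCost s.1 R else 0

/-- The lazy move-all-to-front rule: the access cost is added to the budget of each
requested element; the requested elements whose budget has reached their position move to the front,
and their budget is reset. -/
def lazyStep {n : ℕ} (s : BudgetState n) (R : Request n) : BudgetState n :=
  (moveToFront s.1 (fetchSet s R), fun x => if x ∈ fetchSet s R then 0 else raisedBudget s R x)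

/-- The lists of the algorithm after each of the requests. -/
def lazyRun {n : ℕ} : BudgetState n → List (Request n) → List (ListOrder n)
  | _, [] => []
  | s, R :: Rs => (lazyStep s R).1 :: lazyRun (lazyStep s R) Rs

/-- Lazy move-all-to-front as a deterministic online algorithm. -/
def lazyDet (n : ℕ) : DetAlg n where
  next π₀ Rs := (Rs.foldl lazyStep (π₀, fun _ => 0)).1

/-- Lazy move-all-to-front as a randomized online algorithm; it makes no use of random choices. -/
def lazyRand (n : ℕ) : RandAlg n where
  State := BudgetState n
  init π₀ := PMF.pure (π₀, fun _ => 0)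
  step s R := PMF.pure (lazyStep s R, (lazyStep s R).1)

theorem map_foldl_take_eq_lazyRun {n : ℕ} (s : BudgetState n) (Rs : List (Request n)) :
    ((List.range Rs.length).map fun t => ((Rs.take (t + 1)).foldl lazyStep s).1) =
      lazyRun s Rs := by
  induction Rs generalizing s with
  | nil => rfl
  | cons R Rs ih =>
    rw [List.length_cons, List.range_succ_eq_map, List.map_cons, List.map_map, lazyRun, ← ih]
    simp [Function.comp_def]

theorem lazyDet_run {n : ℕ} (π₀ : ListOrder n) (Rs : List (Request n)) :
    (lazyDet n).run π₀ Rs = lazyRun (π₀, fun _ => 0) Rs :=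
  map_foldl_take_eq_lazyRun _ Rs

theorem lazyRand_runFrom {n : ℕ} (s : BudgetState n) (Rs : List (Request n)) :
    (lazyRand n).runFrom s Rs = PMF.pure (lazyRun s Rs) := by
  induction Rs generalizing s with
  | nil => rfl
  | cons R Rs ih =>
    change (PMF.pure (lazyStep s R, (lazyStep s R).1)).bind
      (fun p => ((lazyRand n).runFrom p.1 Rs).map (List.cons p.2)) = _
    rw [PMF.pure_bind]
    simp only [ih]
    rw [PMF.pure_map]
    rfl

theorem lazyRand_expectedCost {n : ℕ} (π₀ : ListOrder n) (Rs : List (Request n)) :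
    (lazyRand n).expectedCost π₀ Rs = ((lazyDet n).cost π₀ Rs : ℝ≥0∞) := by
  have h : (lazyRand n).run π₀ Rs = PMF.pure (lazyRun (π₀, fun _ => 0) Rs) := by
    exact (PMF.pure_bind (π₀, fun _ => 0) fun s => (lazyRand n).runFrom s Rs).trans
      (lazyRand_runFrom _ _)
  rw [RandAlg.expectedCost, h, tsum_eq_single (lazyRun (π₀, fun _ => 0) Rs), DetAlg.cost,
    lazyDet_run]
  · simp
  · intro πs hπs
    simp [PMF.pure_apply, hπs]

/-! ### The potential -/

/-- The potential of an element at position `p` of the algorithm's list and `q` of the offline list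
with budget `b`. -/
def elementPotential (r p q b : ℕ) : ℕ := 2 * b + (12 * r * (p - 12 * r * q) - 3 * r * b)

/-- The potential that compares the state of the algorithm with the offline list. -/
def potential {n : ℕ} (r : ℕ) (π σ : ListOrder n) (b : Fin n → ℕ) : ℕ :=
  ∑ x, elementPotential r (pos π x) (pos σ x) (b x)

theorem elementPotential_add_budget_le (r p q b l : ℕ) :
    elementPotential r p q (b + l) ≤ elementPotential r p q b + 2 * l := by
  simp only [elementPotential, mul_add]
  omega

/-- Since `12rq < l/2 ≤ p/2`, the excess is at least `p/2`, so `12r` times it is at least `6rp ≥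
3r(b + l)`. The outer subtraction is therefore not truncated, and the second term drops by the full
`3rl`. -/
theorem elementPotential_add_budget_of_far {r p q b l : ℕ} (hlp : l ≤ p) (hb : b ≤ p)
    (hq : 24 * r * q < l) :
    elementPotential r p q (b + l) + 3 * r * l ≤ elementPotential r p q b + 2 * l := by
  have h1 : p ≤ 2 * (p - 12 * r * q) := by
    have : 24 * r * q = 2 * (12 * r * q) := by ring
    omega
  have h2 : 3 * r * b + 3 * r * l ≤ 12 * r * (p - 12 * r * q) := by
    calc 3 * r * b + 3 * r * l = 3 * r * (b + l) := by ring
      _ ≤ 3 * r * (4 * (p - 12 * r * q)) := Nat.mul_le_mul_left _ (by omega)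
      _ = _ := by ring
  simp only [elementPotential, mul_add]
  omega

theorem elementPotential_le_of_excess_le {r p p' q q' b k : ℕ}
    (h : p' - 12 * r * q' ≤ p - 12 * r * q + k) :
    elementPotential r p' q' b ≤ elementPotential r p q b + 12 * r * k := by
  have := Nat.mul_le_mul_left (12 * r) h
  simp only [elementPotential]
  rw [mul_add] at this
  omega

theorem potential_self {n : ℕ} {r : ℕ} (hr : 1 ≤ r) (π : ListOrder n) :
    potential r π π (fun _ => 0) = 0 := by
  refine Finset.sum_eq_zero fun x _ => ?_
  have h : pos π x ≤ 12 * r * pos π x := Nat.le_mul_of_pos_left _ (by omega)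
  simp [elementPotential, Nat.sub_eq_zero_of_le h]

theorem potential_offline_move_le {n : ℕ} (r : ℕ) (π σ σ' : ListOrder n) (b : Fin n → ℕ) :
    potential r π σ' b ≤ potential r π σ b + 144 * r ^ 2 * reorderCost σ σ' := by
  calc potential r π σ' b
      ≤ ∑ x, (elementPotential r (pos π x) (pos σ x) (b x) +
          12 * r * (12 * r * (pos σ x - pos σ' x))) := by
        refine Finset.sum_le_sum fun x _ => elementPotential_le_of_excess_le ?_
        have : 12 * r * pos σ x ≤ 12 * r * pos σ' x + 12 * r * (pos σ x - pos σ' x) := by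
          rw [← mul_add]
          exact Nat.mul_le_mul_left _ (by omega)
        omega
    _ = potential r π σ b + 144 * r ^ 2 * ∑ x, (pos σ x - pos σ' x) := by
        rw [Finset.sum_add_distrib, potential, Finset.mul_sum]
        congr 1
        exact Finset.sum_congr rfl fun x _ => by ring
    _ ≤ _ := by
        gcongr
        exact sum_pos_sub_le_reorderCost σ σ'

theorem accessCost_le_pos {n : ℕ} (π : ListOrder n) (R : Request n) {x : Fin n} (hx : x ∈ R.1) :
    accessCost π R ≤ pos π x := Finset.inf'_le _ hx

theorem potential_raisedBudget_le {n : ℕ} {r : ℕ} (hr : 1 ≤ r) (s : BudgetState n)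
    (σ : ListOrder n) (R : Request n) (hR : R.1.card ≤ r) (hs : ∀ x, s.2 x ≤ pos s.1 x) :
    accessCost s.1 R + potential r s.1 σ (raisedBudget s R) ≤
      potential r s.1 σ s.2 + 144 * r ^ 2 * accessCost σ R := by
  obtain ⟨z, hz, hzm⟩ := Finset.exists_mem_eq_inf' R.2 (pos σ)
  have hzm' : accessCost σ R = pos σ z := hzm
  set l := accessCost s.1 R with hl
  have hlR : R.1.card * (2 * l) ≤ 2 * r * l := by
    calc R.1.card * (2 * l) ≤ r * (2 * l) := Nat.mul_le_mul_right _ hR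
      _ = _ := by ring
  have hrl : l ≤ r * l := Nat.le_mul_of_pos_left _ hr
  have hsum : ∑ x, (if x ∈ R.1 then 2 * l else 0) = R.1.card * (2 * l) := by simp
  -- `z` is the element accessed offline; far, it finances the step itself, and near, the offline
  -- access cost does.
  by_cases hfar : 24 * r * pos σ z < l
  · have h : potential r s.1 σ (raisedBudget s R) + 3 * r * l ≤
        potential r s.1 σ s.2 + R.1.card * (2 * l) := by
      calc potential r s.1 σ (raisedBudget s R) + 3 * r * l
          = ∑ x, (elementPotential r (pos s.1 x) (pos σ x) (raisedBudget s R x) +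
              if x = z then 3 * r * l else 0) := by
            rw [Finset.sum_add_distrib, potential]
            simp
        _ ≤ ∑ x, (elementPotential r (pos s.1 x) (pos σ x) (s.2 x) +
              if x ∈ R.1 then 2 * l else 0) := by
            refine Finset.sum_le_sum fun x _ => ?_
            by_cases hx : x ∈ R.1
            · simp only [raisedBudget, hx, if_true, ← hl]
              by_cases hxz : x = z
              · subst hxz
                simp only [if_true]
                exact elementPotential_add_budget_of_far (accessCost_le_pos _ _ hx) (hs x) hfar
              · simpa [hxz] using elementPotential_add_budget_le r _ _ _ l
            · have hxz : x ≠ z := fun h => hx (h ▸ hz)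
              simp [raisedBudget, hx, hxz]
        _ = _ := by rw [Finset.sum_add_distrib, hsum, potential]
    have h3 : 3 * r * l = 2 * r * l + r * l := by ring
    omega
  · have h : potential r s.1 σ (raisedBudget s R) ≤
        potential r s.1 σ s.2 + R.1.card * (2 * l) := by
      rw [← hsum, potential, potential, ← Finset.sum_add_distrib]
      refine Finset.sum_le_sum fun x _ => ?_
      by_cases hx : x ∈ R.1
      · simpa only [raisedBudget, hx, if_true] using elementPotential_add_budget_le r _ _ _ l
      · simp [raisedBudget, hx]
    have h3 : 3 * r * l ≤ 144 * r ^ 2 * pos σ z := by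
      calc 3 * r * l ≤ 3 * r * (24 * r * pos σ z) := Nat.mul_le_mul_left _ (not_lt.mp hfar)
        _ = 72 * (r ^ 2 * pos σ z) := by ring
        _ ≤ 144 * (r ^ 2 * pos σ z) := Nat.mul_le_mul_right _ (by norm_num)
        _ = _ := by ring
    have h4 : 3 * r * l = 2 * r * l + r * l := by ring
    rw [hzm']
    omega

theorem card_fetchSet_le {n : ℕ} (s : BudgetState n) (R : Request n) :
    (fetchSet s R).card ≤ R.1.card := Finset.card_filter_le _ _

/-- Overtakers from positions up to `M` number at most `M - pos π x`, so they alone cannot push `x`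
beyond `M`. Only those from behind `M` can raise the truncated excess; it is applied with `M =
12rq`. -/
theorem pos_moveToFront_sub_le {n : ℕ} (π : ListOrder n) {F : Finset (Fin n)} {x : Fin n}
    (hx : x ∉ F) (M : ℕ) :
    pos (moveToFront π F) x - M ≤ pos π x - M + (F.filter fun y => M < pos π y).card := by
  rw [pos_moveToFront_of_notMem π hx]
  rcases le_total M (pos π x) with h | h
  · have : (F.filter fun y => pos π x < pos π y).card ≤ (F.filter fun y => M < pos π y).card :=
      Finset.card_le_card (Finset.monotone_filter_right F fun y _ hy => h.trans_lt hy)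
    omega
  · have hsub : (F.filter fun y => pos π x < pos π y) ⊆
        (F.filter fun y => M < pos π y) ∪
          (F.filter fun y => pos π x < pos π y ∧ pos π y ≤ M) := by
      intro y hy
      simp only [Finset.mem_filter, Finset.mem_union] at hy ⊢
      by_cases hM : M < pos π y
      · exact Or.inl ⟨hy.1, hM⟩
      · exact Or.inr ⟨hy.1, hy.2, not_lt.mp hM⟩
    have hc : (F.filter fun y => pos π x < pos π y ∧ pos π y ≤ M).card ≤
        (Finset.Ioc (pos π x) M).card := by
      refine Finset.card_le_card_of_injOn (pos π) (fun y hy => ?_) (pos_injective π).injOn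
      simp only [Finset.coe_filter, Set.mem_ofPred_eq] at hy
      simpa using hy.2
    rw [Nat.card_Ioc] at hc
    have h1 := (Finset.card_le_card hsub).trans (Finset.card_union_le _ _)
    omega

theorem potential_lazyStep_le {n : ℕ} {r : ℕ} (hr : 1 ≤ r) (s : BudgetState n)
    (σ : ListOrder n) (R : Request n) (hR : R.1.card ≤ r) :
    reorderCost s.1 (lazyStep s R).1 + potential r (lazyStep s R).1 σ (lazyStep s R).2 ≤
      potential r s.1 σ (raisedBudget s R) := by
  set F := fetchSet s R with hF
  have hcost : reorderCost s.1 (lazyStep s R).1 ≤ ∑ y ∈ F, pos s.1 y :=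
    reorderCost_moveToFront_le s.1 F
  have hpoint : ∀ x, elementPotential r (pos (lazyStep s R).1 x) (pos σ x) ((lazyStep s R).2 x) +
      (if x ∈ F then 2 * pos s.1 x else 0) ≤
      elementPotential r (pos s.1 x) (pos σ x) (raisedBudget s R x) +
        12 * r * (F.filter fun y => 12 * r * pos σ x < pos s.1 y).card := by
    intro x
    by_cases hx : x ∈ F
    -- A fetched element lands within the first `r` places, so its new potential vanishes.
    · have h1 : pos (lazyStep s R).1 x ≤ 12 * r * pos σ x := by
        calc pos (lazyStep s R).1 x ≤ F.card := pos_moveToFront_of_mem _ hx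
          _ ≤ r := (card_fetchSet_le s R).trans hR
          _ ≤ 12 * r := by omega
          _ ≤ 12 * r * pos σ x := Nat.le_mul_of_pos_right _ (pos_pos σ x)
      have h2 : (lazyStep s R).2 x = 0 := by simp [lazyStep, ← hF, hx]
      have h3 : pos s.1 x ≤ raisedBudget s R x := by
        have h := hx
        rw [hF, fetchSet, Finset.mem_filter] at h
        simpa [raisedBudget, h.1] using h.2
      rw [h2, if_pos hx]
      simp only [elementPotential, Nat.sub_eq_zero_of_le h1]
      omega
    · have h2 : (lazyStep s R).2 x = raisedBudget s R x := by simp [lazyStep, ← hF, hx]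
      rw [h2, if_neg hx, add_zero]
      exact elementPotential_le_of_excess_le (pos_moveToFront_sub_le s.1 hx _)
  have hsum := Finset.sum_le_sum fun x (_ : x ∈ Finset.univ) => hpoint x
  rw [Finset.sum_add_distrib, Finset.sum_add_distrib, ← potential, ← potential] at hsum
  have hleft : ∑ x, (if x ∈ F then 2 * pos s.1 x else 0) = 2 * ∑ y ∈ F, pos s.1 y := by
    rw [Finset.mul_sum]
    simp
  -- Double counting: a fetched `y` charges only those `x` with `12rq < pos s.1 y`, of which there
  -- are at most `pos s.1 y / (12r)`.
  have hright : ∑ x, 12 * r * (F.filter fun y => 12 * r * pos σ x < pos s.1 y).card ≤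
      ∑ y ∈ F, pos s.1 y := by
    rw [← Finset.mul_sum]
    simp only [Finset.card_filter]
    rw [Finset.sum_comm, Finset.mul_sum]
    refine Finset.sum_le_sum fun y _ => ?_
    rw [← Finset.card_filter]
    exact mul_card_filter_mul_pos_lt_le σ (12 * r) (pos s.1 y)
  omega

/-- Unfetched elements never move forward, and a requested one stays unfetched only while its raised
budget is below its position. -/
theorem lazyStep_budget_le_pos {n : ℕ} (s : BudgetState n) (R : Request n)
    (hs : ∀ x, s.2 x ≤ pos s.1 x) (x : Fin n) :
    (lazyStep s R).2 x ≤ pos (lazyStep s R).1 x := by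
  by_cases hx : x ∈ fetchSet s R
  · simp [lazyStep, hx]
  · have h1 : pos s.1 x ≤ pos (lazyStep s R).1 x := by
      rw [lazyStep, pos_moveToFront_of_notMem s.1 hx]
      omega
    have h2 : (lazyStep s R).2 x = raisedBudget s R x := by simp [lazyStep, hx]
    rw [h2]
    refine le_trans ?_ h1
    by_cases hxR : x ∈ R.1
    · have h3 : ¬ pos s.1 x ≤ s.2 x + accessCost s.1 R := fun h =>
        hx (Finset.mem_filter.mpr ⟨hxR, h⟩)
      simp only [raisedBudget, hxR, if_true]
      omega
    · simpa [raisedBudget, hxR] using hs x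

/-! ### Competitiveness -/

theorem totalCost_lazyRun_le {n : ℕ} {r : ℕ} (hr : 1 ≤ r) (Rs : List (Request n))
    (hRs : ∀ R ∈ Rs, R.1.card ≤ r) (s : BudgetState n) (hs : ∀ x, s.2 x ≤ pos s.1 x)
    (σ : ListOrder n) (σs : List (ListOrder n)) (hlen : σs.length = Rs.length) :
    totalCost s.1 Rs (lazyRun s Rs) ≤
      144 * r ^ 2 * totalCost σ Rs σs + potential r s.1 σ s.2 := by
  induction Rs generalizing s σ σs with
  | nil => simp [totalCost]
  | cons R Rs ih =>
    cases σs with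
    | nil => simp at hlen
    | cons σ' σs =>
      have hR : R.1.card ≤ r := hRs R (by simp)
      have h1 := ih (fun S hS => hRs S (by simp [hS])) (lazyStep s R)
        (lazyStep_budget_le_pos s R hs) σ' σs (by simpa using hlen)
      have h2 := potential_raisedBudget_le hr s σ R hR hs
      have h3 := potential_lazyStep_le hr s σ R hR
      have h4 := potential_offline_move_le r (lazyStep s R).1 σ σ' (lazyStep s R).2
      simp only [lazyRun, totalCost, mul_add]
      omega

theorem exists_totalCost_eq_opt {n : ℕ} (π₀ : ListOrder n) (Rs : List (Request n)) :
    ∃ πs : List (ListOrder n), πs.length = Rs.length ∧ totalCost π₀ Rs πs = opt π₀ Rs :=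
  Nat.sInf_mem (s := {k | ∃ πs : List (ListOrder n), πs.length = Rs.length ∧
    totalCost π₀ Rs πs = k}) ⟨_, List.replicate Rs.length π₀, by simp, rfl⟩

theorem lazyDet_cost_le {n r : ℕ} (π₀ : ListOrder n) (Rs : List (Request n))
    (hRs : ∀ R ∈ Rs, R.1.card ≤ r) : (lazyDet n).cost π₀ Rs ≤ 144 * r ^ 2 * opt π₀ Rs := by
  cases Rs with
  | nil => simp [DetAlg.cost, totalCost]
  | cons R Rs =>
    -- Requests are nonempty, so only the empty input allows `r = 0`.
    have hr : 1 ≤ r := R.2.card_pos.trans_le (hRs R (by simp))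
    obtain ⟨πs, hlen, hopt⟩ := exists_totalCost_eq_opt π₀ (R :: Rs)
    have h := totalCost_lazyRun_le hr (R :: Rs) hRs (π₀, fun _ => 0) (fun _ => Nat.zero_le _)
      π₀ πs hlen
    rw [DetAlg.cost, lazyDet_run, ← hopt]
    simpa only [potential_self hr, add_zero] using h

theorem lazyRand_competitive : RandCompetitive lazyRand fun r => 144 * (r : ℝ≥0) ^ 2 := by
  refine ⟨0, fun n r π₀ Rs hRs => ?_⟩
  rw [lazyRand_expectedCost]
  have h : ((lazyDet n).cost π₀ Rs : ℝ≥0∞) ≤ ((144 * r ^ 2 * opt π₀ Rs : ℕ) : ℝ≥0∞) :=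
    Nat.cast_le.mpr (lazyDet_cost_le π₀ Rs hRs)
  simpa using h

theorem lazyDet_competitive : DetCompetitive lazyDet fun r => 144 * (r : ℝ≥0) ^ 4 := by
  refine ⟨0, fun n r π₀ Rs hRs => ?_⟩
  have hpow : r ^ 2 ≤ r ^ 4 := by
    rcases Nat.eq_zero_or_pos r with rfl | hr
    · simp
    · exact Nat.pow_le_pow_right hr (by norm_num)
  have h : ((lazyDet n).cost π₀ Rs : ℝ≥0) ≤ ((144 * r ^ 4 * opt π₀ Rs : ℕ) : ℝ≥0) :=
    Nat.cast_le.mpr ((lazyDet_cost_le π₀ Rs hRs).trans (by gcongr))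
  simpa using h

end MSSC

end

/-- Both parts are witnessed by the lazy move-all-to-front rule, which is deterministic and
`144 r²`-competitive against the dynamic optimum. -/
theorem mainTheorem4 :
    (∃ (A : (n : ℕ) → MSSC.RandAlg n) (C : ℝ≥0),
      MSSC.RandCompetitive A fun r => C * (r : ℝ≥0) ^ 2) ∧
    (∃ (A : (n : ℕ) → MSSC.DetAlg n) (C : ℝ≥0),
      MSSC.DetCompetitive A fun r => C * (r : ℝ≥0) ^ 4) :=
  ⟨⟨MSSC.lazyRand, 144, MSSC.lazyRand_competitive⟩,
    ⟨MSSC.lazyDet, 144, MSSC.lazyDet_competitive⟩⟩
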